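/- Let $K$ be a field and let $S=\bigoplus_{n\ge 0}S_n$ be a commutative graded $K$-algebra with $S_0=K$, generated over $K$ by homogeneous elements $u_1,\dots,u_r$ of positive degrees $a_1,\dots,a_r$; put $D=\operatorname{lcm}(a_1,\dots,a_r)$. Let $M=\bigoplus_{n\ge 0}M_n$ be a finitely generated graded $S$-module of Krull dimension $m\ge 0$, with Hilbert function $H(M,n)=\dim_K M_n$. There are unique functions $d_{M,0},\dots,d_{M,m-1}:\mathbb N\to\mathbb C$, periodic with $d_{M,k}(n+D)=d_{M,k}(n)$ for all $n$, such that $H(M,n)=q_M(n):=\sum_{k=0}^{m-1}d_{M,k}(n)n^k$ for all sufficiently large $n$. Put $$\alpha(M)=\min\{n_0\in\mathbb N: H(M,n)=q_M(n)\ \text{for all } n\ge n_0\},\qquad \alpha'=\max\{\alpha(M),1\},\qquad \theta_M(z)=\sum_{n=1}^{\alpha(M)-1}\frac{H(M,n)}{n^z}.$$ For real $x>0$ let $\zeta(s,x)$ be the Hurwitz zeta function, the meromorphic continuation of $\sum_{n\ge 0}(n+x)^{-s}$. **Proposition 1.6.** The series $\zeta_M(z)=\sum_{n\ge 1}H(M,n)n^{-z}$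 converges absolutely for $\operatorname{Re} z>m$. It extends to a meromorphic function on $\mathbb C$, again denoted $\zeta_M$, and $$\zeta_M(z)=\theta_M(z)+\sum_{k=0}^{m-1}\frac1{D^{z-k}}\sum_{j=0}^{D-1}d_{M,k}(j+\alpha')\,\zeta\!\left(z-k,\frac{j+\alpha'}{D}\right)\qquad(z\in\mathbb C\setminus\{1,\dots,m\}).$$ The function $\zeta_M$ is holomorphic outside $\{1,\dots,m\}$. At each of these points it has at most a simple pole, and $$\operatorname{Res}_{z=k+1}\zeta_M(z)=\frac1D\sum_{j=0}^{D-1}d_{M,k}(j),\qquad 0\le k\le m-1.$$ -/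

import Mathlib

open Filter Topology

noncomputable section

namespace GradedZeta

/-- The Hilbert function `H(M, n) = dim_K M_n` of a graded module with components `ℳ n`. -/
def hilbertFunction {K M : Type*} [Field K] [AddCommGroup M] [Module K M]
    (ℳ : ℕ → Submodule K M) (n : ℕ) : ℕ :=
  Module.finrank K (ℳ n)

/-- The value at `n` of the quasi-polynomial with coefficient functions `d 0, …, d (m - 1)`. -/
def quasiPolynomial {m : ℕ} (d : Fin m → ℕ → ℂ) (n : ℕ) : ℂ :=
  ∑ k : Fin m, d k n * (n : ℂ) ^ (k : ℕ)

/-- `d` is the family of coefficients of a quasi-polynomial of period `D` and degree less than `m`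
that agrees with `H` at all large integers. -/
def IsQuasiPolynomialOf (H : ℕ → ℕ) (D : ℕ) {m : ℕ} (d : Fin m → ℕ → ℂ) : Prop :=
  (∀ k n, d k (n + D) = d k n) ∧ ∀ᶠ n : ℕ in atTop, (H n : ℂ) = quasiPolynomial d n

/-- `α = min {n₀ : H(n) = q(n) for all n ≥ n₀}`. -/
def alpha (H : ℕ → ℕ) {m : ℕ} (d : Fin m → ℕ → ℂ) : ℕ :=
  sInf {n₀ : ℕ | ∀ n, n₀ ≤ n → (H n : ℂ) = quasiPolynomial d n}

/-- `θ(z) = ∑_{n=1}^{α-1} H(n) / n^z`. -/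
def theta (H : ℕ → ℕ) {m : ℕ} (d : Fin m → ℕ → ℂ) (z : ℂ) : ℂ :=
  ∑ n ∈ Finset.Ico 1 (alpha H d), (H n : ℂ) / (n : ℂ) ^ z

/-- The Hurwitz zeta function `ζ(s, x)` for every real `x > 0`, continued to all complex `s ≠ 1`.
Mathlib's `HurwitzZeta.hurwitzZeta` depends on `x` modulo `1` only and is `ζ(s, x)` for
`0 < x ≤ 1`; for larger `x` the terms `(x - 1)^(-s), (x - 2)^(-s), …` with positive base
are removed.  See `hasSum_hurwitz` and `differentiableAt_hurwitz`. -/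
def hurwitz (s : ℂ) (x : ℝ) : ℂ :=
  HurwitzZeta.hurwitzZeta (x : UnitAddCircle) s
    - ∑ i ∈ Finset.range (⌈x⌉₊ - 1), 1 / ((x : ℂ) - ((i : ℂ) + 1)) ^ s

theorem hasSum_hurwitz {s : ℂ} (hs : 1 < s.re) {x : ℝ} (hx : 0 < x) :
    HasSum (fun n : ℕ => 1 / ((n : ℂ) + (x : ℂ)) ^ s) (hurwitz s x) := by
  obtain ⟨N, hN⟩ : ∃ N : ℕ, ⌈x⌉₊ = N + 1 :=
    ⟨⌈x⌉₊ - 1, by have := Nat.ceil_pos.2 hx; omega⟩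
  have h1 : x ≤ N + 1 := by have := Nat.le_ceil x; rw [hN] at this; exact_mod_cast this
  have h2 : (N : ℝ) < x := by
    apply Nat.lt_ceil.1; omega
  have hb : x - N ∈ Set.Icc (0 : ℝ) 1 := ⟨by linarith, by linarith⟩
  have hc : ((x - N : ℝ) : UnitAddCircle) = (x : UnitAddCircle) := by
    have : ((N : ℝ) : UnitAddCircle) = 0 := by
      have h := AddCircle.coe_nsmul (p := (1 : ℝ)) (n := N) (x := 1)
      rw [AddCircle.coe_period, smul_zero] at h
      simpa using h
    rw [AddCircle.coe_sub, this, sub_zero]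
  have h := HurwitzZeta.hasSum_hurwitzZeta_of_one_lt_re hb hs
  rw [hc, ← hasSum_nat_add_iff' N] at h
  have e : ∑ i ∈ Finset.range N, 1 / ((i : ℂ) + ((x - N : ℝ) : ℂ)) ^ s
      = ∑ i ∈ Finset.range (⌈x⌉₊ - 1), 1 / ((x : ℂ) - ((i : ℂ) + 1)) ^ s := by
    rw [hN, Nat.add_sub_cancel, ← Finset.sum_range_reflect]
    refine Finset.sum_congr rfl fun i hi => ?_
    have hi' := Finset.mem_range.1 hi
    have : ((N - 1 - i : ℕ) : ℂ) = (N : ℂ) - 1 - i := by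
      rw [Nat.cast_sub (by omega), Nat.cast_sub (by omega)]; simp
    rw [this]; push_cast; congr 2; ring
  rw [e] at h
  have e2 : (fun n : ℕ => 1 / ((n : ℂ) + (x : ℂ)) ^ s)
      = fun n : ℕ => 1 / (((n + N : ℕ) : ℂ) + ((x - N : ℝ) : ℂ)) ^ s := by
    funext n
    congr 2
    push_cast; ring
  rw [e2]
  exact h

theorem differentiableAt_hurwitz {s : ℂ} (hs : s ≠ 1) (x : ℝ) :
    DifferentiableAt ℂ (fun s => hurwitz s x) s := by
  unfold hurwitz
  refine (HurwitzZeta.differentiableAt_hurwitzZeta _ hs).sub (DifferentiableAt.fun_sum fun i hi => ?_)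
  have hx : 0 < x - (i + 1) := by
    have h1 : i + 1 < ⌈x⌉₊ := by have := Finset.mem_range.1 hi; omega
    have h2 := Nat.lt_ceil.1 h1
    push_cast at h2; linarith
  have h0 : (x : ℂ) - ((i : ℂ) + 1) ≠ 0 := by
    have : (x : ℂ) - ((i : ℂ) + 1) = ((x - (i + 1) : ℝ) : ℂ) := by push_cast; ring
    rw [this]; exact_mod_cast hx.ne'
  refine (differentiableAt_const _).div (differentiableAt_id.const_cpow (Or.inl h0)) ?_
  simp [Complex.cpow_eq_zero_iff, h0]

/-- `f` is holomorphic near `z₀` up to a simple pole (or removable singularity) at `z₀`,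
with residue `c` there: `f(z) = c / (z - z₀) + g(z)` near `z₀`, with `g` analytic at `z₀`. -/
def HasAtMostSimplePoleWithResidue (f : ℂ → ℂ) (z₀ c : ℂ) : Prop :=
  ∃ g : ℂ → ℂ, AnalyticAt ℂ g z₀ ∧ ∀ᶠ z in 𝓝[≠] z₀, f z = c / (z - z₀) + g z

end GradedZeta

end

/-! The quasi-polynomial comes from a Hilbert–Serre induction on the set of generators acting
nontrivially (`hasQuasiPoly_of_supportDim_le`). For a generator `u i`, the kernels of its powers on
the Noetherian module `M` stabilise. Hence `M` is an extension of a quotient on which `u i` is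
regular by a submodule on which it is nilpotent, the latter filtered by modules killed by `u i`. In
the regular case multiplication by `u i` shows that the differences of the Hilbert function with
step `a i` are shifted values of the Hilbert function of `M / u i M`. That quotient has smaller
dimension, and summing differences raises the degree by at most one
(`EventuallyQuasiPoly.of_difference`), so the dimension bounds the degree.

For the zeta function, the terms with `n ≥ max α 1` are split by the power `k` and by residue class
modulo `D`. Writing `n = D (l + x)` gives `n^(k-z) = D^(-(z-k)) (l + x)^(-(z-k))`, which sums over
`l` to a Hurwitz zeta value (`hasSum_zetaOf`). The resulting finite expression is the continuation.
Its only singularities come from the simple poles of `ζ(z - k, x)` at `z = k + 1`, each of residue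
1, so the residue is the mean of `d k` over a period. -/

noncomputable section
-- Eventual quasi-polynomials and their differences.
namespace GradedZeta
open Polynomial

/-- `H` agrees at all large integers with a quasi-polynomial of period `D` and degree less
than `d`. -/
def EventuallyQuasiPoly (D d : ℕ) (H : ℕ → ℂ) : Prop :=
  ∃ P : ℕ → ℂ[X], (∀ n, P (n + D) = P n) ∧ (∀ n, (P n).degree < d) ∧
    ∀ᶠ n : ℕ in atTop, H n = (P n).eval (n : ℂ)

namespace EventuallyQuasiPoly

variable {D d : ℕ} {G H : ℕ → ℂ}

theorem of_eventually_eq_zero (h : ∀ᶠ n in atTop, H n = 0) : EventuallyQuasiPoly D d H :=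
  ⟨fun _ => 0, fun _ => rfl, fun _ => by simp, by simpa using h⟩

theorem add (hG : EventuallyQuasiPoly D d G) (hH : EventuallyQuasiPoly D d H) :
    EventuallyQuasiPoly D d (fun n => G n + H n) := by
  obtain ⟨P, h1, h2, h3⟩ := hG
  obtain ⟨Q, k1, k2, k3⟩ := hH
  refine ⟨fun n => P n + Q n, fun n => by simp only [h1, k1], fun n => ?_, ?_⟩
  · exact (degree_add_le _ _).trans_lt (max_lt (h2 n) (k2 n))
  · filter_upwards [h3, k3] with n a b
    simp [a, b]

theorem shift (hG : EventuallyQuasiPoly D d G) (s : ℕ) :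
    EventuallyQuasiPoly D d (fun n => G (n + s)) := by
  obtain ⟨P, h1, h2, h3⟩ := hG
  refine ⟨fun n => (P (n + s)).comp (X + C (s : ℂ)), fun n => ?_, fun n => ?_, ?_⟩
  · simp only [show n + D + s = n + s + D by ring, h1]
  · by_cases h0 : P (n + s) = 0
    · simp [h0]
    · have := h2 (n + s)
      rw [degree_eq_natDegree h0] at this
      refine degree_le_natDegree.trans_lt ?_
      rw [natDegree_comp, natDegree_X_add_C, mul_one]
      exact this
  · filter_upwards [(tendsto_add_atTop_nat s).eventually h3] with n a
    simp [a]

theorem sum {ι : Type*} {G : ι → ℕ → ℂ} (s : Finset ι)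
    (h : ∀ i ∈ s, EventuallyQuasiPoly D d (G i)) :
    EventuallyQuasiPoly D d (fun n => ∑ i ∈ s, G i n) := by
  classical
  induction s using Finset.induction_on with
  | empty => exact of_eventually_eq_zero (by simp)
  | insert i s hi ih =>
    simp only [Finset.sum_insert hi]
    exact (h i (by simp)).add (ih fun j hj => h j (by simp [hj]))

/-- A polynomial of degree less than `d` is a difference with step `t ≠ 0` of a polynomial of
degree less than `d + 1`. -/
theorem exists_comp_sub_eq {t : ℂ} (ht : t ≠ 0) (d : ℕ) :
    ∀ P : ℂ[X], P.degree < d →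
      ∃ R : ℂ[X], R.degree < (d + 1 : ℕ) ∧ R.comp (X + C t) - R = P := by
  induction d with
  | zero =>
    intro P hP
    have : P = 0 := by
      rw [← degree_eq_bot]; simpa using hP
    exact ⟨0, by simp, by simp [this]⟩
  | succ d ih =>
    intro P hP
    -- The difference of `X ^ (d + 1)` has leading term `(d + 1) t X ^ d`, so a multiple of it
    -- cancels the top coefficient of `P`.
    set E : ℂ[X] := (X + C t) ^ (d + 1) - X ^ (d + 1) with hE
    have hEc : ∀ k, d ≤ k → E.coeff k = if k = d then (d + 1) * t else 0 := by
      intro k hk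
      rw [hE, coeff_sub, coeff_X_add_C_pow, coeff_X_pow]
      rcases hk.eq_or_lt with rfl | hk
      · simp [mul_comm]
      · rcases (Nat.succ_le_of_lt hk).eq_or_lt with rfl | hk'
        · simp
        · simp [Nat.choose_eq_zero_of_lt hk', hk.ne', (show k ≠ d + 1 by omega)]
    have hd : (d + 1 : ℂ) * t ≠ 0 := mul_ne_zero (by exact_mod_cast d.succ_ne_zero) ht
    obtain ⟨R, hR, hR'⟩ := ih (P - C (P.coeff d / ((d + 1) * t)) * E) (by
      rw [degree_lt_iff_coeff_zero]
      intro k hk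
      rw [coeff_sub, coeff_C_mul, hEc k hk]
      split_ifs with h
      · subst h; field_simp; simp
      · have := (degree_lt_iff_coeff_zero _ _).1 hP k (by omega)
        simp [this])
    refine ⟨R + C (P.coeff d / ((d + 1) * t)) * X ^ (d + 1), ?_, ?_⟩
    · refine (degree_add_le _ _).trans_lt (max_lt (hR.trans (by exact_mod_cast Nat.lt_succ_self _)) ?_)
      exact (degree_C_mul_X_pow_le _ _).trans_lt (by exact_mod_cast Nat.lt_succ_self _)
    · rw [add_comp, mul_comp, C_comp, pow_comp, X_comp]
      linear_combination hR'

/-- With step exactly `D` each residue class involves a single polynomial, which is a difference by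
`exists_comp_sub_eq`. Subtracting the antidifference from `H` leaves an eventually `D`-periodic
error, which goes into the constant coefficient. -/
theorem of_period_difference (hD : D ≠ 0) (hG : EventuallyQuasiPoly D d G)
    (h : ∀ᶠ n in atTop, H (n + D) = H n + G n) : EventuallyQuasiPoly D (d + 1) H := by
  obtain ⟨P, h1, h2, h3⟩ := hG
  choose F hF hF' using exists_comp_sub_eq (t := (D : ℂ)) (by exact_mod_cast hD) d
  set R : ℕ → ℂ[X] := fun n => F (P n) (h2 n) with hRdef
  have hRp : ∀ n, R (n + D) = R n := fun n => by simp only [hRdef, h1]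
  obtain ⟨N, hN⟩ := eventually_atTop.1 (h.and h3)
  set e : ℕ → ℂ := fun n => H n - (R n).eval (n : ℂ) with he
  have hstep : ∀ n, N ≤ n → e (n + D) = e n := by
    intro n hn
    obtain ⟨a1, a2⟩ := hN n hn
    have := congrArg (eval (n : ℂ)) (hF' (P n) (h2 n))
    simp only [eval_sub, eval_comp, eval_add, eval_X, eval_C] at this
    simp only [he, hRp, a1, a2, Nat.cast_add]
    simp only [hRdef]
    linear_combination -this
  have hiter : ∀ k n, N ≤ n → e (n + D * k) = e n := by
    intro k
    induction k with
    | zero => simp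
    | succ k ih =>
      intro n hn
      rw [Nat.mul_succ, ← add_assoc, hstep _ (by omega), ih n hn]
  have hDN : ∀ n, N ≤ n + D * N := fun n =>
    (Nat.le_mul_of_pos_left N (Nat.pos_of_ne_zero hD)).trans (Nat.le_add_left _ _)
  -- The error `e` is periodic only from `N` on; moving the argument by `D * N ≥ N` makes the
  -- coefficient periodic at every `n`.
  refine ⟨fun n => R n + C (e (n + D * N)), fun n => ?_, fun n => ?_, ?_⟩
  · simp only [hRp]
    rw [show n + D + D * N = n + D * N + D by ring, hstep _ (hDN n)]
  · refine (degree_add_le _ _).trans_lt (max_lt (hF _ _) (degree_C_le.trans_lt ?_))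
    exact_mod_cast Nat.succ_pos d
  · filter_upwards [eventually_ge_atTop N] with n hn
    rw [hiter N n hn, eval_add, eval_C]
    simp [he]

/-- If the differences of `H` with step `a ∣ D` are a quasi-polynomial of period `D`, so is `H`, and
the degree goes up by at most one. -/
theorem of_difference {a : ℕ} (ha : a ∣ D) (hD : D ≠ 0) (hG : EventuallyQuasiPoly D d G)
    (h : ∀ᶠ n in atTop, H (n + a) = H n + G n) : EventuallyQuasiPoly D (d + 1) H := by
  obtain ⟨b, rfl⟩ := ha
  -- A step of length `D = a * b` telescopes into `b` steps of length `a`.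
  refine of_period_difference hD
    (EventuallyQuasiPoly.sum (Finset.range b) fun i _ => hG.shift (a * i)) ?_
  obtain ⟨N, hN⟩ := eventually_atTop.1 h
  filter_upwards [eventually_ge_atTop N] with n hn
  clear hD hG
  induction b with
  | zero => simp
  | succ b ih =>
    rw [Finset.sum_range_succ, ← add_assoc, ← ih, Nat.mul_succ, ← add_assoc, hN _ (by omega)]

theorem exists_isQuasiPolynomialOf {H : ℕ → ℕ} (h : EventuallyQuasiPoly D d fun n => (H n : ℂ)) :
    ∃ c : Fin d → ℕ → ℂ, IsQuasiPolynomialOf H D c := by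
  obtain ⟨P, h1, h2, h3⟩ := h
  refine ⟨fun k n => (P n).coeff k, fun k n => by simp only [h1], ?_⟩
  filter_upwards [h3] with n hn
  rw [hn, quasiPolynomial, Fin.sum_univ_eq_sum_range (fun k => (P n).coeff k * (n : ℂ) ^ k)]
  by_cases h0 : P n = 0
  · simp [h0]
  · refine eval_eq_sum_range' ?_ _
    rw [natDegree_lt_iff_degree_lt h0]
    exact h2 n

end EventuallyQuasiPoly

theorem add_mul_period {m D : ℕ} {d : Fin m → ℕ → ℂ} (h : ∀ k n, d k (n + D) = d k n)
    (k : Fin m) (n l : ℕ) : d k (n + D * l) = d k n := by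
  induction l with
  | zero => simp
  | succ l ih => rw [Nat.mul_succ, ← add_assoc, h, ih]

/-- The coefficients of a quasi-polynomial are determined by its values at large integers. -/
theorem IsQuasiPolynomialOf.unique {H : ℕ → ℕ} {m D : ℕ} (hD : D ≠ 0) {c d : Fin m → ℕ → ℂ}
    (hc : IsQuasiPolynomialOf H D c) (hd : IsQuasiPolynomialOf H D d) : c = d := by
  funext k j
  obtain ⟨N, hN⟩ := eventually_atTop.1 (hc.2.and hd.2)
  -- On the class of `j` modulo `D` the coefficients are constant, so `p` vanishes at infinitely
  -- many integers.
  set p : ℂ[X] := ∑ k : Fin m, C (c k j - d k j) * X ^ (k : ℕ) with hp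
  have hp0 : p = 0 := by
    refine eq_zero_of_infinite_isRoot p (Set.infinite_of_injective_forall_mem
      (f := fun l : ℕ => ((j + D * (l + N) : ℕ) : ℂ)) ?_ fun l => ?_)
    · intro l l' h
      have h' : j + D * (l + N) = j + D * (l' + N) := Nat.cast_injective (R := ℂ) h
      have := Nat.eq_of_mul_eq_mul_left (Nat.pos_of_ne_zero hD) (Nat.add_left_cancel h')
      omega
    · have hle : N ≤ j + D * (l + N) := by
        have := Nat.le_mul_of_pos_left (l + N) (Nat.pos_of_ne_zero hD)
        omega
      obtain ⟨a1, a2⟩ := hN _ hle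
      rw [a1] at a2
      simp only [quasiPolynomial, add_mul_period hc.1, add_mul_period hd.1] at a2
      rw [Set.mem_ofPred_eq, IsRoot.def, hp, eval_finsetSum]
      simp only [eval_mul, eval_C, eval_pow, eval_X, sub_mul, Finset.sum_sub_distrib]
      rw [a2, sub_self]
  have := congrArg (fun q => q.coeff (k : ℕ)) hp0
  simp only [hp, finsetSum_coeff, coeff_C_mul_X_pow, coeff_zero] at this
  rw [Finset.sum_eq_single k (by
    intro b _ hb; rw [if_neg]; exact fun h => hb (Fin.ext h.symm)) (by simp)] at this
  simpa [sub_eq_zero] using this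

end GradedZeta
end

/-! ### Graded modules and the quasi-polynomiality of their Hilbert functions. -/

noncomputable section
universe w
open scoped Pointwise
namespace GradedZeta

section Exact

variable {K A B C : Type*} [Field K] [AddCommGroup A] [Module K A] [AddCommGroup B] [Module K B]
  [AddCommGroup C] [Module K C]

/-- For an exact sequence `0 → A → B → C → 0` and compatible endomorphisms `p`, `q`, `r`, with `q` idempotent,
the images form an exact sequence, and so their dimensions add up. -/
theorem finrank_range_of_exact (f : A →ₗ[K] B) (g : B →ₗ[K] C) (hf : Function.Injective f)
    (hg : Function.Surjective g) (hfg : LinearMap.range f = LinearMap.ker g)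
    (p : A →ₗ[K] A) (q : B →ₗ[K] B) (r : C →ₗ[K] C) (hq : ∀ b, q (q b) = q b)
    (hpq : ∀ x, q (f x) = f (p x)) (hqr : ∀ b, r (g b) = g (q b))
    [FiniteDimensional K (LinearMap.range p)] [FiniteDimensional K (LinearMap.range r)] :
    FiniteDimensional K (LinearMap.range q) ∧
      Module.finrank K (LinearMap.range q) =
        Module.finrank K (LinearMap.range p) + Module.finrank K (LinearMap.range r) := by
  have hmap : (LinearMap.range q).map g = LinearMap.range r := by
    ext c
    constructor
    · rintro ⟨_, ⟨b, rfl⟩, rfl⟩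
      exact ⟨g b, hqr b⟩
    · rintro ⟨c, rfl⟩
      obtain ⟨b, rfl⟩ := hg c
      exact ⟨q b, ⟨b, rfl⟩, (hqr b).symm⟩
  -- Idempotence of `q` is essential here: if `q b = f x`, then `q b = q (q b) = f (p x)`.
  have hinf : LinearMap.range q ⊓ LinearMap.ker g = (LinearMap.range p).map f := by
    ext b
    constructor
    · rintro ⟨⟨b, rfl⟩, hb⟩
      rw [SetLike.mem_coe, ← hfg] at hb
      obtain ⟨x, hx⟩ := hb
      exact ⟨p x, ⟨x, rfl⟩, by rw [← hpq, hx, hq]⟩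
    · rintro ⟨_, ⟨x, rfl⟩, rfl⟩
      refine ⟨⟨f x, hpq x⟩, ?_⟩
      rw [SetLike.mem_coe, ← hfg]
      exact ⟨_, rfl⟩
  have hfin : FiniteDimensional K (LinearMap.range q) := by
    refine Module.Finite.iff_fg.2 (Submodule.fg_of_fg_map_of_fg_inf_ker g ?_ ?_)
    · rw [hmap]; exact Module.Finite.iff_fg.1 inferInstance
    · rw [hinf]; exact (Module.Finite.iff_fg.1 inferInstance).map f
  refine ⟨hfin, ?_⟩
  have h := LinearMap.finrank_range_add_finrank_ker (g.domRestrict (LinearMap.range q))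
  have h1 : LinearMap.range (g.domRestrict (LinearMap.range q)) = LinearMap.range r := by
    rw [LinearMap.range_domRestrict, hmap]
  have h2 : Module.finrank K (LinearMap.ker (g.domRestrict (LinearMap.range q))) =
      Module.finrank K (LinearMap.range p) := by
    rw [(Submodule.equivMapOfInjective f hf (LinearMap.range p)).finrank_eq, ← hinf,
      ← Submodule.finrank_map_subtype_eq (LinearMap.range q)]
    have : (LinearMap.ker (g.domRestrict (LinearMap.range q))).map (LinearMap.range q).subtype =
        LinearMap.range q ⊓ LinearMap.ker g := by
      ext b
      simp [and_comm]
    rw [this]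
  rw [h1, h2] at h
  omega

end Exact

section Grading

variable {K S : Type*} [Field K] [CommRing S] [Algebra K S] {r : ℕ}

/-- A grading of the `S`-module `M`, given by the projections `π n` onto its components, for which `u i`
has degree `a i`. -/
structure IsGrading (u : Fin r → S) (a : Fin r → ℕ) {M : Type*} [AddCommGroup M] [Module K M]
    [Module S M] (π : ℕ → M →ₗ[K] M) : Prop where
  idem : ∀ n x, π n (π n x) = π n x
  total : ∀ x, ∃ N, ∀ n, N ≤ n → π n x = 0
  smul : ∀ i n x, π (n + a i) (u i • x) = u i • π n x
  smul_low : ∀ i n x, n < a i → π n (u i • x) = 0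

variable {u : Fin r → S} {a : Fin r → ℕ} {M : Type*} [AddCommGroup M] [Module K M]
    [Module S M] [IsScalarTower K S M] {π : ℕ → M →ₗ[K] M}

/-- The restriction of a family of projections to a stable submodule. -/
def subProj (N : Submodule S M) (π : ℕ → M →ₗ[K] M) (hN : ∀ n, ∀ x ∈ N, π n x ∈ N) (n : ℕ) :
    N →ₗ[K] N where
  toFun x := ⟨π n x, hN n x x.2⟩
  map_add' x y := by ext; simp
  map_smul' c x := by ext; simp

/-- The family of projections induced on the quotient by a stable submodule. -/
def quotProj (N : Submodule S M) (π : ℕ → M →ₗ[K] M) (hN : ∀ n, ∀ x ∈ N, π n x ∈ N) (n : ℕ) :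
    (M ⧸ N) →ₗ[K] (M ⧸ N) :=
  (Submodule.Quotient.restrictScalarsEquiv K N).toLinearMap ∘ₗ
    (N.restrictScalars K).mapQ (N.restrictScalars K) (π n) (fun x hx => hN n x hx) ∘ₗ
    (Submodule.Quotient.restrictScalarsEquiv K N).symm.toLinearMap

theorem quotProj_mkQ (N : Submodule S M) (hN : ∀ n, ∀ x ∈ N, π n x ∈ N) (n : ℕ) (x : M) :
    quotProj N π hN n (N.mkQ x) = N.mkQ (π n x) := rfl

namespace IsGrading

theorem sub (h : IsGrading u a π) (N : Submodule S M) (hN : ∀ n, ∀ x ∈ N, π n x ∈ N) :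
    IsGrading u a (subProj N π hN) where
  idem n x := Subtype.ext (h.idem n x)
  total x := by
    obtain ⟨k, hk⟩ := h.total x
    exact ⟨k, fun n hn => Subtype.ext (hk n hn)⟩
  smul i n x := Subtype.ext (h.smul i n x)
  smul_low i n x hn := Subtype.ext (h.smul_low i n x hn)

theorem quot (h : IsGrading u a π) (N : Submodule S M) (hN : ∀ n, ∀ x ∈ N, π n x ∈ N) :
    IsGrading u a (quotProj N π hN) where
  idem n x := by
    obtain ⟨x, rfl⟩ := N.mkQ_surjective x
    simp only [quotProj_mkQ, h.idem]
  total x := by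
    obtain ⟨x, rfl⟩ := N.mkQ_surjective x
    obtain ⟨k, hk⟩ := h.total x
    exact ⟨k, fun n hn => by rw [quotProj_mkQ, hk n hn, map_zero]⟩
  smul i n x := by
    obtain ⟨x, rfl⟩ := N.mkQ_surjective x
    rw [← map_smul, quotProj_mkQ, h.smul, map_smul, quotProj_mkQ]
  smul_low i n x hn := by
    obtain ⟨x, rfl⟩ := N.mkQ_surjective x
    rw [← map_smul, quotProj_mkQ, h.smul_low i n x hn, map_zero]

omit [Algebra K S] [IsScalarTower K S M] in
/-- The kernel of a power of `u i` is stable under the projections. -/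
theorem torsionBy_stable (h : IsGrading u a π) (i : Fin r) (k : ℕ) (n : ℕ) :
    ∀ x ∈ Submodule.torsionBy S M (u i ^ k), π n x ∈ Submodule.torsionBy S M (u i ^ k) := by
  have key : ∀ k n x, π (n + k * a i) (u i ^ k • x) = u i ^ k • π n x := by
    intro k
    induction k with
    | zero => simp
    | succ k ih =>
      intro n x
      rw [pow_succ', mul_smul, Nat.succ_mul, ← add_assoc, h.smul, ih, mul_smul]
  intro x hx
  rw [Submodule.mem_torsionBy_iff] at hx ⊢
  rw [← key, hx, map_zero]

omit [Algebra K S] [IsScalarTower K S M] in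
theorem range_smul_stable (h : IsGrading u a π) (i : Fin r) (n : ℕ) :
    ∀ x ∈ LinearMap.range (LinearMap.lsmul S M (u i)),
      π n x ∈ LinearMap.range (LinearMap.lsmul S M (u i)) := by
  rintro _ ⟨x, rfl⟩
  rw [LinearMap.lsmul_apply]
  rcases lt_or_ge n (a i) with hn | hn
  · rw [h.smul_low i n x hn]; exact Submodule.zero_mem _
  · obtain ⟨n, rfl⟩ := Nat.exists_eq_add_of_le' hn
    rw [h.smul]
    exact ⟨π n x, rfl⟩

end IsGrading

/-- The components of `M` are finite-dimensional, and the Hilbert function is eventually a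
quasi-polynomial of period `D` and degree less than `d`. -/
def HasQuasiPoly (D d : ℕ) (π : ℕ → M →ₗ[K] M) : Prop :=
  (∀ n, FiniteDimensional K (LinearMap.range (π n))) ∧
    EventuallyQuasiPoly D d fun n => (Module.finrank K (LinearMap.range (π n)) : ℂ)

theorem HasQuasiPoly.of_sub_of_quot {D d : ℕ} (h : IsGrading u a π) (N : Submodule S M)
    (hN : ∀ n, ∀ x ∈ N, π n x ∈ N) (h1 : HasQuasiPoly D d (subProj N π hN))
    (h2 : HasQuasiPoly D d (quotProj N π hN)) : HasQuasiPoly D d π := by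
  have key : ∀ n, _ := fun n =>
    have := h1.1 n
    have := h2.1 n
    finrank_range_of_exact (N.subtype.restrictScalars K) (N.mkQ.restrictScalars K)
      N.injective_subtype N.mkQ_surjective (by ext; simp) (subProj N π hN n) (π n)
      (quotProj N π hN n) (h.idem n) (fun _ => rfl) (fun _ => rfl)
  refine ⟨fun n => (key n).1, ?_⟩
  have := h1.2.add h2.2
  convert this using 2 with n
  rw [(key n).2, Nat.cast_add]

/-- If `u i` is regular on `M` then `M` inherits the quasi-polynomial property from `M / u i M`. -/
theorem HasQuasiPoly.of_regular {D d : ℕ} (hD : D ≠ 0) (h : IsGrading u a π) (i : Fin r)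
    (hai : 0 < a i) (haD : a i ∣ D) (hreg : IsSMulRegular M (u i))
    (h2 : HasQuasiPoly D d (quotProj _ π (h.range_smul_stable i))) :
    HasQuasiPoly D (d + 1) π := by
  set N := LinearMap.range (LinearMap.lsmul S M (u i)) with hNdef
  have hinj : Function.Injective ((LinearMap.lsmul S M (u i)).restrictScalars K) := hreg
  -- Here `p` is the projection to degree `n - a i`, or `0` if `n < a i`. Finiteness of its range is
  -- an argument because it is obtained by strong induction on `n`.
  have key : ∀ n p, FiniteDimensional K (LinearMap.range p) →
      (∀ x, π n (u i • x) = u i • p x) → _ := fun n p _ hp =>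
    have := h2.1 n
    finrank_range_of_exact ((LinearMap.lsmul S M (u i)).restrictScalars K)
      (N.mkQ.restrictScalars K) hinj N.mkQ_surjective (by ext; simp [hNdef]) p (π n)
      (quotProj N π (h.range_smul_stable i) n) (h.idem n) hp (fun _ => rfl)
  have hfin : ∀ n, FiniteDimensional K (LinearMap.range (π n)) := by
    intro n
    induction n using Nat.strong_induction_on with
    | _ n ih =>
      rcases lt_or_ge n (a i) with hn | hn
      · refine (key n 0 ?_ fun x => by simp [h.smul_low i n x hn]).1
        rw [LinearMap.range_zero]; infer_instance
      · obtain ⟨k, rfl⟩ := Nat.exists_eq_add_of_le' hn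
        exact (key _ (π k) (ih k (by omega)) fun x => h.smul i k x).1
  refine ⟨hfin, ?_⟩
  refine EventuallyQuasiPoly.of_difference haD hD (h2.2.shift (a i)) (Eventually.of_forall fun n => ?_)
  rw [(key (n + a i) (π n) (hfin n) fun x => h.smul i n x).2, Nat.cast_add]

omit [Algebra K S] [IsScalarTower K S M] in
-- Graded Nakayama: the component in degree `n` is `u i` times the one in degree `n - a i`, and
-- degrees are bounded below.
theorem IsGrading.eq_zero_of_surjective_smul (h : IsGrading u a π) (i : Fin r) (hai : 0 < a i)
    (hsurj : LinearMap.range (LinearMap.lsmul S M (u i)) = ⊤) (n : ℕ) : π n = 0 := by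
  induction n using Nat.strong_induction_on with
  | _ n ih =>
    ext x
    obtain ⟨x, rfl⟩ := LinearMap.range_eq_top.1 hsurj x
    rw [LinearMap.lsmul_apply]
    rcases lt_or_ge n (a i) with hn | hn
    · rw [h.smul_low i n x hn]; rfl
    · obtain ⟨k, rfl⟩ := Nat.exists_eq_add_of_le' hn
      rw [h.smul, ih k (by omega)]; simp

theorem HasQuasiPoly.of_eq_zero {D d : ℕ} (h : ∀ n, π n = 0) : HasQuasiPoly D d π := by
  refine ⟨fun n => ?_, EventuallyQuasiPoly.of_eventually_eq_zero (Eventually.of_forall fun n => ?_)⟩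
  · rw [h, LinearMap.range_zero]; infer_instance
  · have : Module.finrank K (LinearMap.range (π n)) = 0 := by
      rw [h, LinearMap.range_zero, finrank_bot]
    simp [this]

/-- If all generators of the algebra act as zero, then `M` is finite-dimensional. -/
theorem HasQuasiPoly.of_smul_eq_zero {D d : ℕ} (h : IsGrading u a π)
    (hgen : Algebra.adjoin K (Set.range u) = ⊤) [Module.Finite S M]
    (h0 : ∀ i (x : M), u i • x = 0) : HasQuasiPoly D d π := by
  have hscalar : ∀ s : S, ∃ c : K, ∀ x : M, s • x = c • x := by
    intro s
    have hs : s ∈ Algebra.adjoin K (Set.range u) := hgen ▸ Algebra.mem_top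
    induction hs using Algebra.adjoin_induction with
    | mem s hs =>
      obtain ⟨i, rfl⟩ := hs
      exact ⟨0, fun x => by rw [h0, zero_smul]⟩
    | algebraMap c => exact ⟨c, fun x => algebraMap_smul S c x⟩
    | add s t _ _ hs ht =>
      obtain ⟨b, hb⟩ := hs
      obtain ⟨c, hc⟩ := ht
      exact ⟨b + c, fun x => by rw [add_smul, add_smul, hb, hc]⟩
    | mul s t _ _ hs ht =>
      obtain ⟨b, hb⟩ := hs
      obtain ⟨c, hc⟩ := ht
      exact ⟨b * c, fun x => by rw [mul_smul, mul_smul, hc, hb]⟩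
  obtain ⟨T, hT⟩ := Module.Finite.fg_top (R := S) (M := M)
  -- Every element of `S` acts as a scalar of `K`, so generators over `S` already span over `K`.
  have hspan : Submodule.span K (T : Set M) = ⊤ := by
    rw [eq_top_iff]
    intro x _
    have hx : x ∈ Submodule.span S (T : Set M) := hT ▸ Submodule.mem_top
    induction hx using Submodule.span_induction with
    | mem x hx => exact Submodule.subset_span hx
    | zero => exact Submodule.zero_mem _
    | add x y _ _ hx hy => exact Submodule.add_mem _ (hx trivial) (hy trivial)
    | smul s x _ hx =>
      obtain ⟨c, hc⟩ := hscalar s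
      rw [hc]
      exact Submodule.smul_mem _ _ (hx trivial)
  have : FiniteDimensional K M := ⟨⟨T, hspan⟩⟩
  refine ⟨fun n => inferInstance, EventuallyQuasiPoly.of_eventually_eq_zero ?_⟩
  have : ∀ᶠ n in atTop, ∀ x ∈ T, π n x = 0 := by
    rw [eventually_all_finset]
    intro x _
    obtain ⟨N, hN⟩ := h.total x
    exact eventually_atTop.2 ⟨N, hN⟩
  filter_upwards [this] with n hn
  have : π n = 0 := LinearMap.ext_on hspan fun x hx => by simpa using hn x hx
  simp [this]

/-- A regular element avoids the minimal primes of the annihilator, so dividing by it lowers the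
dimension. -/
theorem supportDim_quotient_range_smul_le {d : ℕ} [Module.Finite S M] {x : S} (hx : IsSMulRegular M x)
    (hd : Module.supportDim S M ≤ (d + 1 : ℕ)) :
    Module.supportDim S (M ⧸ LinearMap.range (LinearMap.lsmul S M x)) ≤ d := by
  have hle : Module.supportDim S (QuotSMulTop x M) + 1 ≤ (d + 1 : ℕ) :=
    (Module.supportDim_quotSMulTop_succ_le_of_notMem_minimalPrimes
      fun _ => hx.notMem_of_mem_minimalPrimes).trans hd
  have heq : (x • ⊤ : Submodule S M) = LinearMap.range (LinearMap.lsmul S M x) := by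
    ext y
    simp [Submodule.mem_smul_pointwise_iff_exists]
  rw [← heq]
  change Module.supportDim S (QuotSMulTop x M) ≤ d
  generalize Module.supportDim S (QuotSMulTop x M) = s at hle ⊢
  induction s using WithBot.recBotCoe with
  | bot => exact bot_le
  | coe s =>
    have h1 : s + 1 ≤ (d : ℕ∞) + 1 := by exact_mod_cast hle
    have h2 : s ≤ (d : ℕ∞) := (ENat.add_le_add_iff_right ENat.one_ne_top).1 h1
    exact_mod_cast h2

/-- The Hilbert function of a finitely generated graded module of dimension at most `d`, on which only the
generators `u i` with `i ∈ I` act nontrivially, is eventually a quasi-polynomial of degree less than `d`. -/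
theorem hasQuasiPoly_of_supportDim_le [IsNoetherianRing S]
    (hgen : Algebra.adjoin K (Set.range u) = ⊤) {D : ℕ} (hD : D ≠ 0) (ha : ∀ i, 0 < a i)
    (haD : ∀ i, a i ∣ D) (I : Finset (Fin r)) :
    ∀ (d : ℕ) (M : Type w) [AddCommGroup M] [Module K M] [Module S M] [IsScalarTower K S M]
      [Module.Finite S M] (π : ℕ → M →ₗ[K] M), IsGrading u a π →
      (∀ i ∉ I, ∀ x : M, u i • x = 0) → Module.supportDim S M ≤ d → HasQuasiPoly D d π := by
  induction I using Finset.induction_on with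
  | empty =>
    intro d M _ _ _ _ _ π h h0 _
    exact HasQuasiPoly.of_smul_eq_zero h hgen fun i => h0 i (by simp)
  | insert i I hi ih =>
    have killed : ∀ (M : Type w) [AddCommGroup M] [Module S M],
        (∀ j ∉ insert i I, ∀ x : M, u j • x = 0) → (∀ x : M, u i • x = 0) →
          ∀ j ∉ I, ∀ x : M, u j • x = 0 := by
      intro M _ _ h0 h1 j hj x
      by_cases hji : j = i
      · rw [hji, h1]
      · exact h0 j (by simp [hji, hj]) x
    -- Induction on the exponent: `ker (u i)` is covered by the hypothesis for `I`, and `u i ^ k`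
    -- kills the quotient by it.
    have nilp : ∀ (k d : ℕ) (M : Type w) [AddCommGroup M] [Module K M] [Module S M]
        [IsScalarTower K S M] [Module.Finite S M] (π : ℕ → M →ₗ[K] M), IsGrading u a π →
        (∀ j ∉ insert i I, ∀ x : M, u j • x = 0) → Module.supportDim S M ≤ d →
        (∀ x : M, u i ^ k • x = 0) → HasQuasiPoly D d π := by
      intro k d
      induction k with
      | zero =>
        intro M _ _ _ _ _ π h h0 hd hk
        exact HasQuasiPoly.of_eq_zero fun n => by
          ext x; simpa using hk (π n x)
      | succ k ihk =>
        intro M _ _ _ _ _ π h h0 hd hk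
        have hN := h.torsionBy_stable i 1
        refine HasQuasiPoly.of_sub_of_quot h _ hN ?_ ?_
        · refine ih d _ _ (h.sub _ hN) (killed _ (fun j hj x => Subtype.ext (h0 j hj x)) ?_)
            ((Module.supportDim_le_of_injective _ (Submodule.injective_subtype _)).trans hd)
          intro x
          exact Subtype.ext (by simpa using (Submodule.mem_torsionBy_iff _ _).1 x.2)
        · refine ihk _ _ (h.quot _ hN) (fun j hj x => ?_)
            ((Module.supportDim_le_of_surjective _ (Submodule.mkQ_surjective _)).trans hd)
            fun x => ?_
          · obtain ⟨x, rfl⟩ := Submodule.mkQ_surjective _ x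
            rw [← map_smul, h0 j hj, map_zero]
          · obtain ⟨x, rfl⟩ := Submodule.mkQ_surjective _ x
            rw [← map_smul, Submodule.mkQ_apply, Submodule.Quotient.mk_eq_zero,
              Submodule.mem_torsionBy_iff, smul_smul, pow_one, ← pow_succ', hk]
    have regular : ∀ (d : ℕ) (M : Type w) [AddCommGroup M] [Module K M] [Module S M]
        [IsScalarTower K S M] [Module.Finite S M] (π : ℕ → M →ₗ[K] M), IsGrading u a π →
        (∀ j ∉ insert i I, ∀ x : M, u j • x = 0) → Module.supportDim S M ≤ d →
        IsSMulRegular M (u i) → HasQuasiPoly D d π := by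
      intro d M _ _ _ _ _ π h h0 hd hreg
      cases d with
      | zero =>
        -- In dimension at most `0` the quotient `M / u i M` has dimension `⊥`, so it is zero and
        -- graded Nakayama applies.
        have h1 := (Module.supportDim_quotSMulTop_succ_le_of_notMem_minimalPrimes (R := S) (M := M)
          fun _ => hreg.notMem_of_mem_minimalPrimes).trans hd
        have h2 : Module.supportDim S (QuotSMulTop (u i) M) = ⊥ := by
          generalize Module.supportDim S (QuotSMulTop (u i) M) = s at h1
          induction s using WithBot.recBotCoe with
          | bot => rfl
          | coe s =>
            have h1 : s + 1 ≤ (0 : ℕ∞) := by exact_mod_cast h1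
            simp at h1
        rw [Module.supportDim_eq_bot_iff_subsingleton, Submodule.Quotient.subsingleton_iff]
          at h2
        refine HasQuasiPoly.of_eq_zero (h.eq_zero_of_surjective_smul i (ha i) ?_)
        rw [← h2]
        ext y
        simp [Submodule.mem_smul_pointwise_iff_exists]
      | succ d =>
        refine HasQuasiPoly.of_regular hD h i (ha i) (haD i) hreg ?_
        refine ih d _ _ (h.quot _ _) (killed _ (fun j hj x => ?_) fun x => ?_)
          (supportDim_quotient_range_smul_le hreg hd)
        · obtain ⟨x, rfl⟩ := Submodule.mkQ_surjective _ x
          rw [← map_smul, h0 j hj, map_zero]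
        · obtain ⟨x, rfl⟩ := Submodule.mkQ_surjective _ x
          rw [← map_smul, Submodule.mkQ_apply, Submodule.Quotient.mk_eq_zero]
          exact ⟨x, rfl⟩
    intro d M _ _ _ _ _ π h h0 hd
    obtain ⟨k, hk⟩ := monotone_stabilizes_iff_noetherian.2
      (inferInstance : IsNoetherian S M)
      ⟨fun k => Submodule.torsionBy S M (u i ^ k), fun k l hkl x hx => by
        rw [Submodule.mem_torsionBy_iff] at hx ⊢
        rw [← Nat.sub_add_cancel hkl, pow_add, mul_smul, hx, smul_zero]⟩
    have hN := h.torsionBy_stable i k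
    refine HasQuasiPoly.of_sub_of_quot h _ hN ?_ ?_
    · refine nilp k d _ _ (h.sub _ hN) (fun j hj x => Subtype.ext (h0 j hj x))
        ((Module.supportDim_le_of_injective _ (Submodule.injective_subtype _)).trans hd) ?_
      exact fun x => Subtype.ext ((Submodule.mem_torsionBy_iff _ _).1 x.2)
    · refine regular d _ _ (h.quot _ hN) (fun j hj x => ?_)
        ((Module.supportDim_le_of_surjective _ (Submodule.mkQ_surjective _)).trans hd) ?_
      · obtain ⟨x, rfl⟩ := Submodule.mkQ_surjective _ x
        rw [← map_smul, h0 j hj, map_zero]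
      -- If `u i • x` is killed by `u i ^ k`, then `x` is killed by `u i ^ (k + 1)`, hence by `u i ^
      -- k` as the kernels have stabilised.
      · rw [isSMulRegular_quotient_iff_mem_of_smul_mem]
        intro x hx
        have h1 := hk (k + 1) (Nat.le_succ k)
        change Submodule.torsionBy S M (u i ^ k) = Submodule.torsionBy S M (u i ^ (k + 1)) at h1
        rw [h1, Submodule.mem_torsionBy_iff, pow_succ, mul_smul]
        exact (Submodule.mem_torsionBy_iff _ _).1 hx

end Grading

/-- Over a finitely generated graded algebra the Hilbert function of a finitely generated graded module of
dimension `m` has finite values, and is eventually a quasi-polynomial of degree less than `m`. -/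
theorem eventuallyQuasiPoly_hilbertFunction {K S M : Type*} [Field K] [CommRing S] [Algebra K S]
    (𝒜 : ℕ → Submodule K S) {r : ℕ} (u : Fin r → S) (a : Fin r → ℕ) (ha : ∀ i, 0 < a i)
    (hu : ∀ i, u i ∈ 𝒜 (a i)) (hgen : Algebra.adjoin K (Set.range u) = ⊤)
    [AddCommGroup M] [Module K M] [Module S M] [IsScalarTower K S M] [Module.Finite S M]
    (ℳ : ℕ → Submodule K M) [DirectSum.Decomposition ℳ] [SetLike.GradedSMul 𝒜 ℳ]
    {m D : ℕ} (hm : Module.supportDim S M ≤ m) (hD : D ≠ 0) (haD : ∀ i, a i ∣ D) :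
    EventuallyQuasiPoly D m fun n => (hilbertFunction ℳ n : ℂ) := by
  classical
  have : IsNoetherianRing S := by
    have : Algebra.FiniteType K S := ⟨⟨Finset.univ.image u, by simpa using hgen⟩⟩
    exact Algebra.FiniteType.isNoetherianRing K S
  set π : ℕ → M →ₗ[K] M := fun n =>
    (ℳ n).subtype ∘ₗ DirectSum.component K ℕ (fun n => ℳ n) n ∘ₗ
      (DirectSum.decomposeLinearEquiv ℳ).toLinearMap with hπ
  have hπa : ∀ n x, π n x = (DirectSum.decompose ℳ x n : M) := fun n x => rfl
  have hsame : ∀ n, ∀ x ∈ ℳ n, π n x = x := fun n x hx =>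
    DirectSum.decompose_of_mem_same ℳ hx
  have hne : ∀ n k, ∀ x ∈ ℳ k, k ≠ n → π n x = 0 := fun n k x hx hk =>
    DirectSum.decompose_of_mem_ne ℳ hx hk
  have hmem : ∀ n x, π n x ∈ ℳ n := fun n x => (DirectSum.decompose ℳ x n).2
  have hsmul : ∀ i k, ∀ x ∈ ℳ k, u i • x ∈ ℳ (k + a i) := fun i k x hx => by
    rw [add_comm]
    exact SetLike.GradedSMul.smul_mem (hu i) hx
  have hrange : ∀ n, LinearMap.range (π n) = ℳ n := fun n => by
    ext x
    exact ⟨by rintro ⟨x, rfl⟩; exact hmem n x, fun hx => ⟨x, hsame n x hx⟩⟩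
  have hgr : IsGrading u a π :=
    { idem := fun n x => hsame n _ (hmem n x)
      total := fun x => by
        refine ⟨(DirectSum.decompose ℳ x).support.sup id + 1, fun n hn => ?_⟩
        rw [hπa]
        by_contra h
        have : n ∈ (DirectSum.decompose ℳ x).support := by
          rw [DFinsupp.mem_support_iff]
          exact fun h' => h (by rw [h']; rfl)
        have := Finset.le_sup (f := id) this
        simp only [id] at this
        omega
      smul := fun i n x => by
        induction x using DirectSum.Decomposition.inductionOn ℳ with
        | zero => simp
        | add x y hx hy => rw [smul_add, map_add, map_add, hx, hy, smul_add]
        | @homogeneous k x =>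
          by_cases hk : k = n
          · subst hk
            rw [hsame _ _ x.2, hsame _ _ (hsmul i _ _ x.2)]
          · rw [hne n k _ x.2 hk, hne _ _ _ (hsmul i k _ x.2) (by omega), smul_zero]
      smul_low := fun i n x hn => by
        induction x using DirectSum.Decomposition.inductionOn ℳ with
        | zero => simp
        | add x y hx hy => rw [smul_add, map_add, hx, hy, add_zero]
        | @homogeneous k x => exact hne _ _ _ (hsmul i k _ x.2) (by omega) }
  have := (hasQuasiPoly_of_supportDim_le hgen hD ha haD Finset.univ m M π hgr
    (fun i hi => absurd (Finset.mem_univ i) hi) hm).2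
  have hH : (fun n => (hilbertFunction ℳ n : ℂ)) =
      fun n => (Module.finrank K (LinearMap.range (π n)) : ℂ) := by
    funext n
    rw [hrange, hilbertFunction]
  rw [hH]
  exact this

end GradedZeta
end

/-! ### Hurwitz zeta functions, poles and the Dirichlet series. -/

noncomputable section
namespace GradedZeta

/-- A function that is holomorphic in a punctured neighbourhood of `z₀`, with
`(z - z₀) f(z) → c`, has at most a simple pole with residue `c`. -/
theorem hasAtMostSimplePoleWithResidue_of_tendsto {f : ℂ → ℂ} {z₀ c : ℂ}
    (hf : ∀ᶠ z in 𝓝[≠] z₀, DifferentiableAt ℂ f z)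
    (hc : Tendsto (fun z => (z - z₀) * f z) (𝓝[≠] z₀) (𝓝 c)) :
    HasAtMostSimplePoleWithResidue f z₀ c := by
  -- By Riemann's removable singularity theorem `F` is analytic; its difference quotient at `z₀` is
  -- then the regular part of `f`.
  set F : ℂ → ℂ := Function.update (fun z => (z - z₀) * f z) z₀ c with hF
  have hFa : AnalyticAt ℂ F z₀ := by
    refine Complex.analyticAt_of_differentiable_on_punctured_nhds_of_continuousAt ?_
      (continuousAt_update_same.2 hc)
    filter_upwards [hf, self_mem_nhdsWithin] with z hz hne
    have h1 : DifferentiableAt ℂ (fun z => (z - z₀) * f z) z := by fun_prop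
    refine h1.congr_of_eventuallyEq ?_
    filter_upwards [isOpen_ne.mem_nhds hne] with w hw
    exact Function.update_of_ne hw _ _
  obtain ⟨p, hp⟩ := hFa
  refine ⟨dslope F z₀, hp.has_fpower_series_dslope_fslope.analyticAt, ?_⟩
  filter_upwards [self_mem_nhdsWithin] with z hz
  have hz0 : z - z₀ ≠ 0 := sub_ne_zero.2 hz
  rw [dslope_of_ne _ hz, slope_def_field, hF, Function.update_self, Function.update_of_ne hz]
  field_simp
  ring

theorem HasAtMostSimplePoleWithResidue.meromorphicAt {f : ℂ → ℂ} {z₀ c : ℂ}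
    (h : HasAtMostSimplePoleWithResidue f z₀ c) : MeromorphicAt f z₀ := by
  obtain ⟨g, hg, he⟩ := h
  have h1 : MeromorphicAt (fun z => c / (z - z₀) + g z) z₀ :=
    ((MeromorphicAt.const c z₀).div ((MeromorphicAt.id z₀).sub (MeromorphicAt.const z₀ z₀))).add
      hg.meromorphicAt
  exact h1.congr (he.mono fun z hz => hz.symm)

/-- The Hurwitz zeta function has residue `1` at `s = 1`. -/
theorem tendsto_sub_one_mul_hurwitz (x : ℝ) :
    Tendsto (fun s => (s - 1) * hurwitz s x) (𝓝[≠] 1) (𝓝 1) := by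
  have h1 := HurwitzZeta.hurwitzZeta_residue_one (x : UnitAddCircle)
  have h2 : ContinuousAt (fun s : ℂ => (s - 1) * ∑ i ∈ Finset.range (⌈x⌉₊ - 1),
      1 / ((x : ℂ) - ((i : ℂ) + 1)) ^ s) 1 := by
    refine (continuousAt_id.sub continuousAt_const).mul (tendsto_finsetSum _ fun i hi => ?_)
    have hx : 0 < x - (i + 1) := by
      have h1 : i + 1 < ⌈x⌉₊ := by have := Finset.mem_range.1 hi; omega
      have h2 := Nat.lt_ceil.1 h1
      push_cast at h2; linarith
    have h0 : (x : ℂ) - ((i : ℂ) + 1) ≠ 0 := by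
      have : (x : ℂ) - ((i : ℂ) + 1) = ((x - (i + 1) : ℝ) : ℂ) := by push_cast; ring
      rw [this]; exact_mod_cast hx.ne'
    have h3 : ContinuousAt (fun s : ℂ => 1 / ((x : ℂ) - ((i : ℂ) + 1)) ^ s) 1 :=
      continuousAt_const.div (continuousAt_id.const_cpow (Or.inl h0))
        (by simp [h0])
    exact h3
  have h3 := h1.sub (h2.tendsto.mono_left nhdsWithin_le_nhds)
  simp only [sub_self, zero_mul, sub_zero] at h3
  refine h3.congr fun s => ?_
  rw [hurwitz, mul_sub]

/-- A series over `ℕ` may be summed over the residue classes modulo `D`. -/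
theorem hasSum_of_residueClasses {D : ℕ} (hD : D ≠ 0) {f : ℕ → ℂ} {s : ℕ → ℂ}
    (h : ∀ j < D, HasSum (fun l : ℕ => f (j + D * l)) (s j)) :
    HasSum f (∑ j ∈ Finset.range D, s j) := by
  have h1 : ∀ j ∈ Finset.range D, HasSum (fun n => if n % D = j then f n else 0) (s j) := by
    intro j hj
    have hj' := Finset.mem_range.1 hj
    have hinj : Function.Injective fun l : ℕ => j + D * l := fun l l' h =>
      Nat.eq_of_mul_eq_mul_left (Nat.pos_of_ne_zero hD) (Nat.add_left_cancel h)
    rw [← hinj.hasSum_iff]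
    · convert h j hj' using 2 with l
      simp [Nat.add_mul_mod_self_left, Nat.mod_eq_of_lt hj']
    · intro n hn
      refine if_neg fun hnj => hn ⟨n / D, ?_⟩
      have := Nat.mod_add_div n D
      simp only
      omega
  have h2 := hasSum_sum h1
  convert h2 using 2 with n
  rw [Finset.sum_ite_eq, if_pos (Finset.mem_range.2 (Nat.mod_lt _ (Nat.pos_of_ne_zero hD)))]

/-- The Hurwitz zeta expression for the Dirichlet series of a function `H` that agrees at
large integers with the quasi-polynomial with coefficients `d`. -/
def zetaOf (H : ℕ → ℕ) (D : ℕ) {m : ℕ} (d : Fin m → ℕ → ℂ) (z : ℂ) : ℂ :=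
  theta H d z + ∑ k : Fin m, 1 / (D : ℂ) ^ (z - ((k : ℕ) : ℂ)) *
    ∑ j ∈ Finset.range D, d k (j + max (alpha H d) 1) *
      hurwitz (z - ((k : ℕ) : ℂ)) (((j + max (alpha H d) 1 : ℕ) : ℝ) / (D : ℝ))

section

variable {H : ℕ → ℕ} {D m : ℕ} {d : Fin m → ℕ → ℂ}

/-- Eventual agreement makes the set defining `alpha` nonempty, so its infimum is attained. -/
theorem IsQuasiPolynomialOf.eq_of_alpha_le (h : IsQuasiPolynomialOf H D d) {n : ℕ}
    (hn : alpha H d ≤ n) : (H n : ℂ) = quasiPolynomial d n :=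
  Nat.sInf_mem (s := {n₀ : ℕ | ∀ n, n₀ ≤ n → (H n : ℂ) = quasiPolynomial d n})
    (eventually_atTop.1 h.2) n hn

theorem differentiable_theta : Differentiable ℂ (theta H d) := by
  intro z
  unfold theta
  refine DifferentiableAt.fun_sum fun n hn => ?_
  have h0 : (n : ℂ) ≠ 0 := by
    have := (Finset.mem_Ico.1 hn).1
    exact_mod_cast (show n ≠ 0 by omega)
  exact (differentiableAt_const _).div (differentiableAt_id.const_cpow (Or.inl h0))
    (by simp [h0])

theorem differentiableAt_zetaOf_summand (hD : D ≠ 0) (k : Fin m) (b : ℕ) (z : ℂ)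
    (hz : z ≠ (k : ℕ) + 1) :
    DifferentiableAt ℂ (fun z : ℂ => 1 / (D : ℂ) ^ (z - ((k : ℕ) : ℂ)) *
      ∑ j ∈ Finset.range D, d k (j + b) *
        hurwitz (z - ((k : ℕ) : ℂ)) (((j + b : ℕ) : ℝ) / (D : ℝ))) z := by
  have hD' : (D : ℂ) ≠ 0 := by exact_mod_cast hD
  have hsub : DifferentiableAt ℂ (fun z : ℂ => z - ((k : ℕ) : ℂ)) z := by fun_prop
  refine ((differentiableAt_const _).div (hsub.const_cpow (Or.inl hD')) (by simp [hD'])).mul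
    (DifferentiableAt.fun_sum fun j _ => (differentiableAt_const _).mul ?_)
  exact (differentiableAt_hurwitz (fun h => hz (by linear_combination h)) _).comp
    (f := fun z : ℂ => z - ((k : ℕ) : ℂ)) z hsub

theorem differentiableAt_zetaOf (hD : D ≠ 0) {z : ℂ} (hz : ∀ k : Fin m, z ≠ (k : ℕ) + 1) :
    DifferentiableAt ℂ (zetaOf H D d) z := by
  unfold zetaOf
  exact differentiable_theta.differentiableAt.add
    (DifferentiableAt.fun_sum fun k _ => differentiableAt_zetaOf_summand hD k _ z (hz k))

theorem eventually_ne_poles (z₀ : ℂ) :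
    ∀ᶠ z : ℂ in 𝓝[≠] z₀, ∀ k : Fin m, z ≠ (k : ℕ) + 1 := by
  rw [eventually_all]
  intro k
  by_cases h : z₀ = (k : ℕ) + 1
  · rw [← h]; exact self_mem_nhdsWithin
  · exact nhdsWithin_le_nhds (isOpen_ne.mem_nhds h)

theorem analyticAt_zetaOf (hD : D ≠ 0) {z : ℂ} (hz : ∀ k : Fin m, z ≠ (k : ℕ) + 1) :
    AnalyticAt ℂ (zetaOf H D d) z := by
  refine Complex.analyticAt_of_differentiable_on_punctured_nhds_of_continuousAt
    ?_ (differentiableAt_zetaOf hD hz).continuousAt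
  filter_upwards [eventually_ne_poles (m := m) z] with w hw
  exact differentiableAt_zetaOf hD hw

/-- This removes the shift by `max α 1` from the residue. -/
theorem sum_range_add_of_periodic {D : ℕ} {f : ℕ → ℂ} (hf : ∀ n, f (n + D) = f n) (b : ℕ) :
    ∑ j ∈ Finset.range D, f (j + b) = ∑ j ∈ Finset.range D, f j := by
  induction b with
  | zero => simp
  | succ b ih =>
    rw [← ih]
    have h1 := Finset.sum_range_succ (fun j => f (j + b)) D
    rw [Finset.sum_range_succ'] at h1
    simp only [zero_add, add_comm D b, hf] at h1
    simpa only [add_assoc, add_comm 1 b] using add_right_cancel h1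

/-- After multiplication by `z - z₀` only the summand `k` survives in the limit: its power of `D`
tends to `1 / D` and each Hurwitz factor contributes `1`. -/
theorem hasAtMostSimplePoleWithResidue_zetaOf (hD : D ≠ 0) (hd : ∀ k n, d k (n + D) = d k n)
    (k : Fin m) :
    HasAtMostSimplePoleWithResidue (zetaOf H D d) ((k : ℕ) + 1)
      (1 / (D : ℂ) * ∑ j ∈ Finset.range D, d k j) := by
  have hD' : (D : ℂ) ≠ 0 := by exact_mod_cast hD
  set z₀ : ℂ := (k : ℕ) + 1 with hz₀
  refine hasAtMostSimplePoleWithResidue_of_tendsto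
    ((eventually_ne_poles (m := m) z₀).mono fun z hz => differentiableAt_zetaOf hD hz) ?_
  set b := max (alpha H d) 1 with hb
  set T : Fin m → ℂ → ℂ := fun i z => 1 / (D : ℂ) ^ (z - ((i : ℕ) : ℂ)) *
      ∑ j ∈ Finset.range D, d i (j + b) *
        hurwitz (z - ((i : ℕ) : ℂ)) (((j + b : ℕ) : ℝ) / (D : ℝ)) with hT
  have hvan : ∀ g : ℂ → ℂ, ContinuousAt g z₀ →
      Tendsto (fun z => (z - z₀) * g z) (𝓝[≠] z₀) (𝓝 0) := by
    intro g hg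
    have : ContinuousAt (fun z => (z - z₀) * g z) z₀ :=
      (continuousAt_id.sub continuousAt_const).mul hg
    simpa using this.tendsto.mono_left (nhdsWithin_le_nhds (s := {z₀}ᶜ))
  have hterm : ∀ i : Fin m, Tendsto (fun z => (z - z₀) * T i z) (𝓝[≠] z₀)
      (𝓝 (if i = k then 1 / (D : ℂ) * ∑ j ∈ Finset.range D, d k j else 0)) := by
    intro i
    split_ifs with hik
    · subst hik
      have hsub : Tendsto (fun z : ℂ => z - ((i : ℕ) : ℂ)) (𝓝[≠] z₀) (𝓝[≠] 1) := by
        refine tendsto_nhdsWithin_iff.2 ⟨?_, ?_⟩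
        · have : ContinuousAt (fun z : ℂ => z - ((i : ℕ) : ℂ)) z₀ := by fun_prop
          simpa [hz₀] using this.tendsto.mono_left (nhdsWithin_le_nhds (s := {z₀}ᶜ))
        · filter_upwards [self_mem_nhdsWithin] with z hz h
          exact hz (by rw [Set.mem_singleton_iff] at h ⊢; rw [hz₀, ← h]; ring)
      have hpow : Tendsto (fun z : ℂ => 1 / (D : ℂ) ^ (z - ((i : ℕ) : ℂ))) (𝓝[≠] z₀)
          (𝓝 (1 / (D : ℂ))) := by
        have hc : ContinuousAt (fun z : ℂ => 1 / (D : ℂ) ^ (z - ((i : ℕ) : ℂ))) z₀ := by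
          refine continuousAt_const.div (ContinuousAt.const_cpow (by fun_prop) (Or.inl hD')) ?_
          simp [hD']
        simpa [hz₀] using hc.tendsto.mono_left (nhdsWithin_le_nhds (s := {z₀}ᶜ))
      have hsum := tendsto_finsetSum (Finset.range D) fun j (_ : j ∈ Finset.range D) =>
        (((tendsto_sub_one_mul_hurwitz (((j + b : ℕ) : ℝ) / (D : ℝ))).comp hsub).const_mul
          (d i (j + b)))
      have := hpow.mul hsum
      simp only [mul_one, sum_range_add_of_periodic (hd i)] at this
      refine this.congr fun z => ?_
      simp only [hT, Function.comp_apply, hz₀, Finset.mul_sum]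
      exact Finset.sum_congr rfl fun j _ => by ring
    · refine hvan _ (differentiableAt_zetaOf_summand hD i b z₀ ?_).continuousAt
      intro h
      rw [hz₀, add_left_inj, Nat.cast_inj] at h
      exact hik (Fin.ext h.symm)
  have := (hvan _ (differentiable_theta (H := H) (d := d)).continuous.continuousAt).add
    (tendsto_finsetSum Finset.univ fun i _ => hterm i)
  simp only [Finset.sum_ite_eq', Finset.mem_univ, if_true, zero_add] at this
  refine this.congr fun z => ?_
  rw [zetaOf, mul_add, Finset.mul_sum]

theorem hasSum_zetaOf (hD : D ≠ 0) (h : IsQuasiPolynomialOf H D d) {z : ℂ} (hz : (m : ℝ) < z.re) :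
    HasSum (fun n : ℕ => (H (n + 1) : ℂ) / ((n + 1 : ℕ) : ℂ) ^ z) (zetaOf H D d z) := by
  set b := max (alpha H d) 1 with hb
  have hb1 : 1 ≤ b := le_max_right _ _
  have htheta : theta H d z = ∑ n ∈ Finset.range (b - 1), (H (n + 1) : ℂ) / ((n + 1 : ℕ) : ℂ) ^ z := by
    rw [theta]
    -- When `alpha` is `0` both intervals are empty; the series starts at `n = 1`, so `theta` is its
    -- first `b - 1` terms.
    have : Finset.Ico 1 (alpha H d) = Finset.Ico 1 b := by
      ext n; simp only [Finset.mem_Ico, hb, lt_max_iff]; omega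
    rw [this, Finset.sum_Ico_eq_sum_range]
    simp only [add_comm 1]
  rw [zetaOf, htheta, add_comm, ← hasSum_nat_add_iff' (b - 1)]
  rw [add_sub_cancel_right]
  simp only [← hb]
  have hterm : ∀ n : ℕ, (H (n + (b - 1) + 1) : ℂ) / ((n + (b - 1) + 1 : ℕ) : ℂ) ^ z =
      ∑ k : Fin m, d k (n + b) * (((n + b : ℕ) : ℂ) ^ (k : ℕ) / ((n + b : ℕ) : ℂ) ^ z) := by
    intro n
    rw [show n + (b - 1) + 1 = n + b by omega,
      h.eq_of_alpha_le (le_trans (le_max_left _ 1) (Nat.le_add_left b n)), quasiPolynomial,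
      Finset.sum_div]
    exact Finset.sum_congr rfl fun k _ => by ring
  simp only [hterm]
  refine hasSum_sum fun k _ => ?_
  rw [Finset.mul_sum]
  refine hasSum_of_residueClasses hD fun j _ => ?_
  have hre : 1 < (z - ((k : ℕ) : ℂ)).re := by
    have : ((k : ℕ) : ℝ) + 1 ≤ m := by exact_mod_cast k.2
    rw [Complex.sub_re, Complex.natCast_re]
    linarith
  have hx : 0 < ((j + b : ℕ) : ℝ) / (D : ℝ) := by
    have : 0 < j + b := by omega
    positivity
  have hs := ((hasSum_hurwitz hre hx).mul_left (d k (j + b))).mul_left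
    (1 / (D : ℂ) ^ (z - ((k : ℕ) : ℂ)))
  refine Eq.subst (motive := fun f => HasSum f _) (funext fun l => ?_) hs
  symm
  rw [show j + D * l + b = j + b + D * l by ring, add_mul_period h.1]
  have hn0 : ((j + b + D * l : ℕ) : ℂ) ≠ 0 := by
    exact_mod_cast (show j + b + D * l ≠ 0 by omega)
  have hfac : ((j + b + D * l : ℕ) : ℂ) =
      ((D : ℝ) : ℂ) * (((l : ℝ) + ((j + b : ℕ) : ℝ) / (D : ℝ) : ℝ) : ℂ) := by
    rw [← Complex.ofReal_mul, ← Complex.ofReal_natCast]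
    congr 1
    have : (D : ℝ) ≠ 0 := by exact_mod_cast hD
    field_simp
    push_cast
    ring
  have hpow : ((j + b + D * l : ℕ) : ℂ) ^ (k : ℕ) / ((j + b + D * l : ℕ) : ℂ) ^ z =
      1 / ((j + b + D * l : ℕ) : ℂ) ^ (z - ((k : ℕ) : ℂ)) := by
    rw [Complex.cpow_sub _ _ hn0, Complex.cpow_natCast, one_div_div]
  -- The complex power splits over the product because both factors are nonnegative reals.
  rw [hpow, hfac, Complex.mul_cpow_ofReal_nonneg (by positivity) (by positivity)]
  push_cast
  rw [one_div, one_div, one_div, mul_inv]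
  ring

end

end GradedZeta
end

theorem proposition1p6 {K S M : Type*} [Field K] [CommRing S] [Algebra K S]
    -- `S` is a positively graded `K`-algebra with `S₀ = K`
    (𝒜 : ℕ → Submodule K S) [GradedAlgebra 𝒜] (h𝒜 : 𝒜 0 = Submodule.span K {(1 : S)})
    -- generated by homogeneous elements `u i` of positive degrees `a i`
    {r : ℕ} (u : Fin r → S) (a : Fin r → ℕ) (ha : ∀ i, 0 < a i) (hu : ∀ i, u i ∈ 𝒜 (a i))
    (hgen : Algebra.adjoin K (Set.range u) = ⊤)
    -- `M` is a finitely generated graded `S`-module of Krull dimension `m`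
    [AddCommGroup M] [Module K M] [Module S M] [IsScalarTower K S M] [Module.Finite S M]
    (ℳ : ℕ → Submodule K M) [DirectSum.Decomposition ℳ] [SetLike.GradedSMul 𝒜 ℳ]
    (m : ℕ) (hm : Module.supportDim S M = (m : WithBot ℕ∞))
    -- the period
    (D : ℕ) (hD : D = Finset.univ.lcm a) :
    (∃! d : Fin m → ℕ → ℂ,
      GradedZeta.IsQuasiPolynomialOf (GradedZeta.hilbertFunction ℳ) D d) ∧
    ∀ d : Fin m → ℕ → ℂ,
      GradedZeta.IsQuasiPolynomialOf (GradedZeta.hilbertFunction ℳ) D d →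
      ∃ ζM : ℂ → ℂ,
        -- `ζM` is given by the Dirichlet series where it converges (absolutely) ...
        (∀ z : ℂ, (m : ℝ) < z.re →
          HasSum (fun n : ℕ =>
            (GradedZeta.hilbertFunction ℳ (n + 1) : ℂ) / ((n + 1 : ℕ) : ℂ) ^ z) (ζM z)) ∧
        -- ... and everywhere by the formula in terms of Hurwitz zeta functions
        (∀ z : ℂ, (∀ k : Fin m, z ≠ (k : ℕ) + 1) →
          ζM z = GradedZeta.theta (GradedZeta.hilbertFunction ℳ) d z +
            ∑ k : Fin m, 1 / (D : ℂ) ^ (z - ((k : ℕ) : ℂ)) *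
              ∑ j ∈ Finset.range D,
                d k (j + max (GradedZeta.alpha (GradedZeta.hilbertFunction ℳ) d) 1) *
                GradedZeta.hurwitz (z - ((k : ℕ) : ℂ))
                  (((j + max (GradedZeta.alpha (GradedZeta.hilbertFunction ℳ) d) 1 : ℕ) : ℝ)
                    / (D : ℝ))) ∧
        MeromorphicOn ζM Set.univ ∧
        (∀ z : ℂ, (∀ k : Fin m, z ≠ (k : ℕ) + 1) → AnalyticAt ℂ ζM z) ∧
        (∀ k : Fin m, GradedZeta.HasAtMostSimplePoleWithResidue ζM ((k : ℕ) + 1)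
          (1 / (D : ℂ) * ∑ j ∈ Finset.range D, d k j)) := by
  have hDi : ∀ i, a i ∣ D := fun i => hD ▸ Finset.dvd_lcm (Finset.mem_univ i)
  -- For `r = 0` the empty lcm is `1`.
  have hD0 : D ≠ 0 := by
    rw [hD, Ne, Finset.lcm_eq_zero_iff]
    rintro ⟨i, -, hi⟩
    exact (ha i).ne' hi
  obtain ⟨c, hc⟩ := (GradedZeta.eventuallyQuasiPoly_hilbertFunction 𝒜 u a ha hu hgen ℳ hm.le hD0
    hDi).exists_isQuasiPolynomialOf
  refine ⟨⟨c, hc, fun d hd => hd.unique hD0 hc⟩, fun d hd => ?_⟩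
  refine ⟨GradedZeta.zetaOf (GradedZeta.hilbertFunction ℳ) D d,
    fun z hz => GradedZeta.hasSum_zetaOf hD0 hd hz, fun z _ => rfl, fun z _ => ?_,
    fun z hz => GradedZeta.analyticAt_zetaOf hD0 hz,
    GradedZeta.hasAtMostSimplePoleWithResidue_zetaOf hD0 hd.1⟩
  by_cases hz : ∀ k : Fin m, z ≠ (k : ℕ) + 1
  · exact (GradedZeta.analyticAt_zetaOf hD0 hz).meromorphicAt
  · push Not at hz
    obtain ⟨k, rfl⟩ := hz
    exact (GradedZeta.hasAtMostSimplePoleWithResidue_zetaOf hD0 hd.1 k).meromorphicAt
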